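/- For each $n\ge 1$ let $S_{b_2}$ be the set of permutations $\pi$ of $\{1,\dots,n\}$ with $\pi(i)\ge i-1$ for all $i\in\{2,\dots,n\}$ (the corresponding restriction vector is $b_2=[1,1,2,3,\dots,n-1]$). Let $C_{n,k}$ be the number of $k$-cycles of a uniformly random element of $S_{b_2}$, where a $1$-cycle is a fixed point. Put $$\mu_{n,k}=\frac{n-k+3}{2^{k+1}},\qquad \sigma_{n,k}^2=\frac{(2^{k+1}-2k+3)\,n+3k(k-4)+(3-k)2^{k+1}+5}{4^{k+1}},$$ and let $\sigma_{n,k}$ be the non-negative square root of $\sigma_{n,k}^2$ (which is positive for all sufficiently large $n$). Then for every fixed positive integer $k$ and every $t\in\mathbb{R}$, $$P\left(\frac{C_{n,k}-\mu_{n,k}}{\sigma_{n,k}}<t\right)\longrightarrow\frac1{\sqrt{2\pi}}\int_{-\infty}^t e^{-x^2/2}\,dx\qquad\text{as } n\to\infty .$$ -/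

import Mathlib

open MeasureTheory ProbabilityTheory Filter Topology

namespace RestrictedPerm

/-- The permutations `π` of `{1, …, n}` with `π(i) ≥ i - 1` for all `i ∈ {2, …, n}`.
The element `i : Fin n` stands for the number `i + 1`, so that the index `i ∈ {2, …, n}` is
`1 ≤ i`, and `π(i) ≥ i - 1` reads `i ≤ π i + 1`, free of truncated subtraction. -/
def regularPerms (n : ℕ) : Set (Equiv.Perm (Fin n)) :=
  {π | ∀ i : Fin n, 1 ≤ (i : ℕ) → (i : ℕ) ≤ (π i : ℕ) + 1}

/-- The number of `k`-cycles of `π`; the `1`-cycles are the fixed points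
(`Equiv.Perm.partition` is the full cycle type, fixed points included). -/
def cycleCount {n : ℕ} (k : ℕ) (π : Equiv.Perm (Fin n)) : ℕ :=
  π.partition.parts.count k

/-- Every set of permutations is an event. -/
instance instMeasurableSpacePerm (n : ℕ) : MeasurableSpace (Equiv.Perm (Fin n)) := ⊤

/-- The law of a uniformly random element of `regularPerms n`. -/
noncomputable def uniformLaw (n : ℕ) : Measure (Equiv.Perm (Fin n)) :=
  uniformOn (regularPerms n)

/-- The centering constant `μ_{n,k}`. -/
noncomputable def mean (n k : ℕ) : ℝ := ((n : ℝ) - k + 3) / 2 ^ (k + 1)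

/-- The squared scaling constant `σ²_{n,k}`. -/
noncomputable def variance (n k : ℕ) : ℝ :=
  (((2 : ℝ) ^ (k + 1) - 2 * k + 3) * n + 3 * k * ((k : ℝ) - 4)
    + (3 - (k : ℝ)) * 2 ^ (k + 1) + 5) / 4 ^ (k + 1)

/-- The scaling constant `σ_{n,k}`, the square root of `σ²_{n,k}`. -/
noncomputable def stdDev (n k : ℕ) : ℝ := √(variance n k)

end RestrictedPerm

/-!
A permutation with `π(i) ≥ i - 1` is a direct sum of cycles `i ↦ i - 1` on consecutive intervals:
the points beyond the position of the largest value form such a cycle together with that position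
(`regularPerms_apply_of_gt`, `exists_blockSum_eq`), and the remaining points carry a shorter
permutation of the same kind. Hence the number of `k`-cycles is the number of parts `k` in a
uniformly random composition of `n`, and the polynomials `a_n(u) = ∑ u ^ C_k(π)` satisfy
`a_{n+1} = 2 a_n + (u - 1) (a_{n+1-k} - a_{n-k})` (`cyclePoly_recurrence`).

The characteristic function of the standardised count is `a_n(u) / 2 ^ (n - 1)` at `u = exp (i θ)`,
up to a phase, with `θ = t / σ_{n,k}` of order `n ^ (-1/2)`. Instead of locating the dominant root of
the characteristic equation, divide `a_n` by `(2 λ) ^ n` with the explicit approximate root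
`λ = exp (i c θ - v θ² / 2)`, where `c` and `v` are the limits of `μ_{n,k} / n` and `σ²_{n,k} / n`.
The quotients stay bounded on `[0, n]`, since `|a_m| ≤ 2 ^ m` and `n θ²` converges. They satisfy a
recurrence whose coefficients sum to `1 + o(θ²)` (`decay_add_pert_isLittleO`), and a sum of finitely
many consecutive terms with suitable weights then moves by `o(1 / n)` per step
(`norm_sub_le_of_recurrence`). So the quotient at `n` has the same limit `1 / 2` as the quotient at
the fixed index `k`, which makes the characteristic functions converge to `exp (-t² / 2)`
(`tendsto_cyclePoly`). Lévy's convergence theorem and the absence of atoms finish the proof.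
-/

namespace RestrictedPerm

/-! ### Cycle type of a direct sum -/

section CycleType

variable {α β : Type*} [Fintype α] [DecidableEq α] [Fintype β] [DecidableEq β]

theorem cycleType_permCongr (e : α ≃ β) (σ : Equiv.Perm α) :
    (e.permCongr σ).cycleType = σ.cycleType := by
  let f : α ≃ Subtype (fun _ : β => True) := e.trans (Equiv.subtypeUnivEquiv fun _ => trivial).symm
  rw [← Equiv.Perm.cycleType_extendDomain f (g := σ)]
  congr 1

theorem cycleType_sumCongr (σ : Equiv.Perm α) (τ : Equiv.Perm β) :
    (σ.sumCongr τ).cycleType = σ.cycleType + τ.cycleType := by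
  have h1 : (Equiv.Perm.sumCongr σ (1 : Equiv.Perm β)).cycleType = σ.cycleType := by
    rw [← Equiv.Perm.cycleType_extendDomain
      (Equiv.ofInjective (Sum.inl : α → α ⊕ β) Sum.inl_injective) (g := σ)]
    congr 1
    ext (a | b)
    · rw [show (Sum.inl a : α ⊕ β) = (Equiv.ofInjective (Sum.inl : α → α ⊕ β)
        Sum.inl_injective a : α ⊕ β) from rfl, Equiv.Perm.extendDomain_apply_image]
      simp
    · rw [Equiv.Perm.extendDomain_apply_not_subtype _ _ (by simp)]
      simp
  have h2 : (Equiv.Perm.sumCongr (1 : Equiv.Perm α) τ).cycleType = τ.cycleType := by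
    rw [← Equiv.Perm.cycleType_extendDomain
      (Equiv.ofInjective (Sum.inr : β → α ⊕ β) Sum.inr_injective) (g := τ)]
    congr 1
    ext (a | b)
    · rw [Equiv.Perm.extendDomain_apply_not_subtype _ _ (by simp)]
      simp
    · rw [show (Sum.inr b : α ⊕ β) = (Equiv.ofInjective (Sum.inr : β → α ⊕ β)
        Sum.inr_injective b : α ⊕ β) from rfl, Equiv.Perm.extendDomain_apply_image]
      simp
  have h : σ.sumCongr τ = Equiv.Perm.sumCongr σ 1 * Equiv.Perm.sumCongr 1 τ := by
    rw [Equiv.Perm.sumCongr_mul, mul_one, one_mul]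
  have hd : (Equiv.Perm.sumCongr σ (1 : Equiv.Perm β)).Disjoint (Equiv.Perm.sumCongr 1 τ) := by
    rintro (a | b) <;> simp
  rw [h, hd.cycleType_mul, h1, h2]

theorem parts_partition_eq (σ : Equiv.Perm α) : σ.partition.parts =
    σ.cycleType + Multiset.replicate (Fintype.card α - σ.cycleType.sum) 1 := by
  rw [Equiv.Perm.parts_partition, Equiv.Perm.sum_cycleType]

theorem parts_partition_sumCongr {γ : Type*} [Fintype γ] [DecidableEq γ] (e : α ⊕ β ≃ γ)
    (σ : Equiv.Perm α) (τ : Equiv.Perm β) :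
    (e.permCongr (σ.sumCongr τ)).partition.parts = σ.partition.parts + τ.partition.parts := by
  have hσ : σ.cycleType.sum ≤ Fintype.card α := by
    rw [Equiv.Perm.sum_cycleType]; exact Finset.card_le_univ _
  have hτ : τ.cycleType.sum ≤ Fintype.card β := by
    rw [Equiv.Perm.sum_cycleType]; exact Finset.card_le_univ _
  rw [parts_partition_eq, parts_partition_eq σ, parts_partition_eq τ, cycleType_permCongr,
    cycleType_sumCongr, ← Fintype.card_congr e, Fintype.card_sum, Multiset.sum_add,
    show Fintype.card α + Fintype.card β - (σ.cycleType.sum + τ.cycleType.sum)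
      = (Fintype.card α - σ.cycleType.sum) + (Fintype.card β - τ.cycleType.sum) by omega,
    Multiset.replicate_add]
  abel

theorem parts_partition_finRotate_inv (j : ℕ) :
    ((finRotate (j + 1))⁻¹ : Equiv.Perm (Fin (j + 1))).partition.parts = {j + 1} := by
  rw [parts_partition_eq, Equiv.Perm.cycleType_inv]
  cases j with
  | zero => rw [finRotate_one, show Equiv.refl (Fin 1) = 1 from rfl]; simp
  | succ j => rw [cycleType_finRotate]; simp

end CycleType

/-! ### Splitting off the last block -/

/-- The direct sum of `σ` with the cycle `i ↦ i - 1` on a last block of `j + 1` points. -/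
def blockSum {m : ℕ} (j : ℕ) (σ : Equiv.Perm (Fin m)) : Equiv.Perm (Fin (m + (j + 1))) :=
  finSumFinEquiv.permCongr (σ.sumCongr (finRotate (j + 1))⁻¹)

theorem blockSum_castAdd {m : ℕ} (j : ℕ) (σ : Equiv.Perm (Fin m)) (i : Fin m) :
    blockSum j σ (Fin.castAdd (j + 1) i) = Fin.castAdd (j + 1) (σ i) := by
  simp [blockSum]

theorem blockSum_natAdd_zero {m : ℕ} (j : ℕ) (σ : Equiv.Perm (Fin m)) :
    blockSum j σ (Fin.natAdd m 0) = Fin.natAdd m (Fin.last j) := by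
  have : (finRotate (j + 1)).symm 0 = Fin.last j := by
    rw [Equiv.symm_apply_eq, finRotate_last]
  simp only [blockSum, Equiv.permCongr_apply, finSumFinEquiv_symm_apply_natAdd,
    Equiv.Perm.sumCongr_apply, Sum.map_inr, finSumFinEquiv_apply_right, Equiv.Perm.inv_def, this]

theorem blockSum_natAdd_succ {m : ℕ} (j : ℕ) (σ : Equiv.Perm (Fin m)) (i : Fin j) :
    blockSum j σ (Fin.natAdd m i.succ) = Fin.natAdd m i.castSucc := by
  have : (finRotate (j + 1)).symm i.succ = i.castSucc := by
    rw [Equiv.symm_apply_eq, finRotate_apply, Fin.coeSucc_eq_succ]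
  simp only [blockSum, Equiv.permCongr_apply, finSumFinEquiv_symm_apply_natAdd,
    Equiv.Perm.sumCongr_apply, Sum.map_inr, finSumFinEquiv_apply_right, Equiv.Perm.inv_def, this]

theorem blockSum_injective {m : ℕ} (j : ℕ) :
    Function.Injective (blockSum j : Equiv.Perm (Fin m) → _) := by
  intro σ τ h
  ext i
  have := congrArg (fun π => ((π (Fin.castAdd (j + 1) i) : Fin _) : ℕ)) h
  simpa only [blockSum_castAdd, Fin.val_castAdd] using this

theorem cycleCount_blockSum {m : ℕ} (j k : ℕ) (σ : Equiv.Perm (Fin m)) :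
    cycleCount k (blockSum j σ) = cycleCount k σ + if k = j + 1 then 1 else 0 := by
  rw [cycleCount, blockSum, parts_partition_sumCongr, parts_partition_finRotate_inv,
    Multiset.count_add, Multiset.count_singleton, cycleCount]

theorem blockSum_mem_regularPerms {m : ℕ} (j : ℕ) {σ : Equiv.Perm (Fin m)} :
    blockSum j σ ∈ regularPerms (m + (j + 1)) ↔ σ ∈ regularPerms m := by
  constructor
  · intro h i hi
    simpa [blockSum_castAdd] using h (Fin.castAdd (j + 1) i) (by simpa using hi)
  · intro h i hi
    induction i using Fin.addCases with
    | left i => simpa [blockSum_castAdd] using h i (by simpa using hi)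
    | right i =>
      induction i using Fin.cases with
      | zero => rw [blockSum_natAdd_zero]; simp; omega
      | succ i => rw [blockSum_natAdd_succ]; simp; omega

/-- If `π(m)` is the largest point, then every later point moves down by exactly one: the points
above `i` already take all values that are at least `i`. -/
theorem regularPerms_apply_of_gt {m j : ℕ} {π : Equiv.Perm (Fin (m + (j + 1)))}
    (hπ : π ∈ regularPerms (m + (j + 1))) (hm : π (Fin.natAdd m 0) = Fin.natAdd m (Fin.last j))
    (i : Fin (m + (j + 1))) (hi : m < i) : (π i : ℕ) + 1 = i := by
  obtain ⟨d, hd⟩ : ∃ d, d + (i : ℕ) = m + j := ⟨m + j - i, by omega⟩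
  induction d using Nat.strong_induction_on generalizing i with
  | _ d ih =>
    by_contra hne
    have h1 := hπ i (by omega)
    have h2 : (π i : ℕ) ≤ m + j := by omega
    -- a value `π i ≥ i` is either the largest one, taken by `m`, or already taken by the later point
    -- `π i + 1`
    rcases h2.eq_or_lt with h3 | h3
    · have : π i = π (Fin.natAdd m 0) := by rw [hm]; ext; simp [h3]
      have := π.injective this
      subst this
      simp at hi
    · have h4 := ih (m + j - ((π i : ℕ) + 1)) (by omega) ⟨(π i : ℕ) + 1, by omega⟩
        (by simp; omega) (by simp; omega)
      simp only [Nat.add_right_cancel_iff] at h4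
      have := congrArg Fin.val (π.injective (Fin.ext h4))
      simp at this
      omega

theorem regularPerms_apply_lt {m j : ℕ} {π : Equiv.Perm (Fin (m + (j + 1)))}
    (hπ : π ∈ regularPerms (m + (j + 1))) (hm : π (Fin.natAdd m 0) = Fin.natAdd m (Fin.last j))
    (i : Fin (m + (j + 1))) (hi : (i : ℕ) < m) : (π i : ℕ) < m := by
  by_contra! hlt
  have h2 : (π i : ℕ) ≤ m + j := by omega
  rcases h2.eq_or_lt with h3 | h3
  · have : π i = π (Fin.natAdd m 0) := by rw [hm]; ext; simp [h3]
    have := π.injective this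
    subst this
    simp at hi
  · have h4 := regularPerms_apply_of_gt hπ hm ⟨(π i : ℕ) + 1, by omega⟩ (by simp; omega)
    simp only [Nat.add_right_cancel_iff] at h4
    have := congrArg Fin.val (π.injective (Fin.ext h4))
    simp at this
    omega

/-- A permutation of the class whose largest value sits at `m` splits off the last block. -/
theorem exists_blockSum_eq {m j : ℕ} {π : Equiv.Perm (Fin (m + (j + 1)))}
    (hπ : π ∈ regularPerms (m + (j + 1))) (hm : π (Fin.natAdd m 0) = Fin.natAdd m (Fin.last j)) :
    ∃ σ ∈ regularPerms m, blockSum j σ = π := by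
  have hmaps : Set.MapsTo (finSumFinEquiv.symm.permCongr π)
      (Set.range (Sum.inl : Fin m → Fin m ⊕ Fin (j + 1))) (Set.range Sum.inl) := by
    rintro _ ⟨i, rfl⟩
    refine ⟨⟨π (Fin.castAdd (j + 1) i), regularPerms_apply_lt hπ hm _ (by simp)⟩, ?_⟩
    rw [← finSumFinEquiv.injective.eq_iff]
    ext
    simp
  obtain ⟨⟨σ, τ⟩, h⟩ := Equiv.Perm.mem_sumCongrHom_range_of_perm_mapsTo_inl hmaps
  have hσ : blockSum j σ = π := by
    refine Equiv.ext fun i => ?_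
    induction i using Fin.addCases with
    | left i =>
      have := congrArg (fun ρ => finSumFinEquiv (ρ (Sum.inl i))) h
      simpa [blockSum_castAdd] using this
    | right i =>
      induction i using Fin.cases with
      | zero => rw [blockSum_natAdd_zero, hm]
      | succ i =>
        have := regularPerms_apply_of_gt hπ hm (Fin.natAdd m i.succ) (by simp)
        rw [blockSum_natAdd_succ]
        ext
        simp at this ⊢
        omega
  exact ⟨σ, (blockSum_mem_regularPerms j).1 (hσ ▸ hπ), hσ⟩

/-! ### The cycle-counting polynomials and their recurrence -/

/-- The cycle-counting polynomial `∑ u ^ C_k(π)` over the permutations of the class. -/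
noncomputable def cyclePoly (k : ℕ) (u : ℂ) (n : ℕ) : ℂ :=
  ∑ π ∈ (regularPerms n).toFinite.toFinset, u ^ cycleCount k π

theorem sum_regularPerms_apply_eq_last (k : ℕ) (u : ℂ) (m j : ℕ) :
    ∑ π ∈ (regularPerms (m + (j + 1))).toFinite.toFinset with
      π (Fin.natAdd m 0) = Fin.natAdd m (Fin.last j), u ^ cycleCount k π
      = (if k = j + 1 then u else 1) * cyclePoly k u m := by
  rw [cyclePoly, Finset.mul_sum]
  symm
  refine Finset.sum_bij (fun σ _ => blockSum j σ) ?_ ?_ ?_ ?_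
  · intro σ hσ
    simpa [blockSum_natAdd_zero, blockSum_mem_regularPerms] using hσ
  · intro σ _ τ _ h
    exact blockSum_injective j h
  · intro π hπ
    simp only [Finset.mem_filter, Set.Finite.mem_toFinset] at hπ
    obtain ⟨σ, hσ, h⟩ := exists_blockSum_eq hπ.1 hπ.2
    exact ⟨σ, by simpa using hσ, h⟩
  · intro σ _
    rw [cycleCount_blockSum, pow_add]
    split_ifs <;> simp [mul_comm]

/-- The permutations are grouped by the position `m` of the largest value, which is the first point
of the last block. -/
theorem cyclePoly_succ_eq_sum (k : ℕ) (u : ℂ) (n : ℕ) :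
    cyclePoly k u (n + 1) =
      ∑ m ∈ Finset.range (n + 1), (if k = n - m + 1 then u else 1) * cyclePoly k u m := by
  rw [cyclePoly, ← Finset.sum_fiberwise _ (fun π => π.symm (Fin.last n)), Finset.sum_range]
  refine Finset.sum_congr rfl fun a _ => ?_
  obtain ⟨m, hm⟩ := a
  obtain ⟨j, rfl⟩ : ∃ j, n = m + j := ⟨n - m, by omega⟩
  rw [show m + j - m = j by omega, ← sum_regularPerms_apply_eq_last]
  refine Finset.sum_congr (Finset.filter_congr fun π _ => ?_) fun _ _ => rfl
  rw [Equiv.symm_apply_eq, eq_comm]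
  rfl

theorem cyclePoly_zero (k : ℕ) (u : ℂ) : cyclePoly k u 0 = 1 := by
  have h : (regularPerms 0).toFinite.toFinset = {1} := by
    ext π
    simp [regularPerms, Subsingleton.elim π 1]
  rw [cyclePoly, h, Finset.sum_singleton]
  simp [cycleCount, parts_partition_eq]

/-- Removing the last block and subtracting consecutive instances turns the full-history
recurrence into one of bounded length. -/
theorem cyclePoly_recurrence (k : ℕ) (u : ℂ) (q m : ℕ) (hq : k = q + 1) :
    cyclePoly k u (m + q + 2) = 2 * cyclePoly k u (m + q + 1)
      + (u - 1) * (cyclePoly k u (m + 1) - cyclePoly k u m) := by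
  have key : ∀ p, cyclePoly k u (p + q + 1) =
      ∑ i ∈ Finset.range (p + q + 1), cyclePoly k u i + (u - 1) * cyclePoly k u p := by
    intro p
    have : ∀ i ∈ Finset.range (p + q + 1),
        (if k = p + q - i + 1 then u else 1) * cyclePoly k u i
          = cyclePoly k u i + if i = p then (u - 1) * cyclePoly k u i else 0 := by
      intro i hi
      rw [Finset.mem_range] at hi
      by_cases h : i = p
      · subst h
        rw [if_pos (by omega), if_pos rfl]; ring
      · rw [if_neg (by omega), if_neg h]; ring
    rw [cyclePoly_succ_eq_sum, Finset.sum_congr rfl this, Finset.sum_add_distrib,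
      Finset.sum_ite_eq' (Finset.range (p + q + 1)) p, if_pos (by simp)]
  have h1 := key (m + 1)
  have h0 := key m
  rw [show m + 1 + q + 1 = m + q + 1 + 1 by ring, Finset.sum_range_succ] at h1
  rw [show m + q + 2 = m + q + 1 + 1 by ring, h1, h0]
  ring

theorem cyclePoly_one (k : ℕ) (n : ℕ) : cyclePoly k 1 (n + 1) = 2 ^ n := by
  have key : ∀ n, cyclePoly k 1 (n + 1) = ∑ m ∈ Finset.range (n + 1), cyclePoly k 1 m := by
    intro n
    simp [cyclePoly_succ_eq_sum]
  induction n with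
  | zero => simp [key, cyclePoly_zero k]
  | succ n ih => rw [key, Finset.sum_range_succ, ← key, ih]; ring

theorem card_regularPerms (n : ℕ) :
    (regularPerms (n + 1)).toFinite.toFinset.card = 2 ^ n := by
  have := cyclePoly_one 1 n
  simp only [cyclePoly, one_pow, Finset.sum_const, nsmul_eq_mul, mul_one] at this
  exact_mod_cast this

theorem norm_cyclePoly_le (k : ℕ) {u : ℂ} (hu : ‖u‖ = 1) (n : ℕ) :
    ‖cyclePoly k u n‖ ≤ 2 ^ n := by
  have hcard : ((regularPerms n).toFinite.toFinset.card : ℝ) ≤ 2 ^ n := by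
    cases n with
    | zero => exact_mod_cast Finset.card_le_univ _
    | succ n =>
      rw [card_regularPerms]
      push_cast
      exact pow_le_pow_right₀ (by norm_num) (by omega)
  refine (norm_sum_le _ _).trans (le_trans ?_ hcard)
  simp [hu]

theorem continuous_cyclePoly (k n : ℕ) : Continuous fun u => cyclePoly k u n := by
  unfold cyclePoly
  fun_prop

/-! ### Second-order expansions at the origin -/

/-- The function `f` has the expansion `f z = a + b z + c z² + o(z²)` at the origin. -/
def HasTwoJet (f : ℂ → ℂ) (a b c : ℂ) : Prop :=
  (fun z => f z - (a + b * z + c * z ^ 2)) =o[𝓝 0] fun z => z ^ 2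

theorem isLittleO_mul_sq_of_tendsto_zero {f : ℂ → ℂ} (hf : Tendsto f (𝓝 0) (𝓝 0)) :
    (fun z => f z * z ^ 2) =o[𝓝 0] fun z : ℂ => z ^ 2 := by
  simpa using ((Asymptotics.isLittleO_one_iff ℂ).2 hf).mul_isBigO
    (Asymptotics.isBigO_refl (fun z : ℂ => z ^ 2) (𝓝 0))

theorem HasTwoJet.const (a : ℂ) : HasTwoJet (fun _ => a) a 0 0 := by
  simp [HasTwoJet]

theorem HasTwoJet.add {f g : ℂ → ℂ} {a b c a' b' c' : ℂ} (hf : HasTwoJet f a b c)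
    (hg : HasTwoJet g a' b' c') : HasTwoJet (fun z => f z + g z) (a + a') (b + b') (c + c') :=
  (Asymptotics.IsLittleO.add hf hg).congr_left fun z => by ring

theorem HasTwoJet.mul {f g : ℂ → ℂ} {a b c a' b' c' : ℂ} (hf : HasTwoJet f a b c)
    (hg : HasTwoJet g a' b' c') :
    HasTwoJet (fun z => f z * g z) (a * a') (a * b' + b * a') (a * c' + b * b' + c * a') := by
  have hP : (fun z : ℂ => a + b * z + c * z ^ 2) =O[𝓝 0] fun _ => (1 : ℂ) :=
    (show Continuous fun z : ℂ => a + b * z + c * z ^ 2 by fun_prop).continuousAt.tendsto.isBigO_one ℂ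
  have hQ : (fun z : ℂ => a' + b' * z + c' * z ^ 2) =O[𝓝 0] fun _ => (1 : ℂ) :=
    (show Continuous fun z : ℂ => a' + b' * z + c' * z ^ 2 by
      fun_prop).continuousAt.tendsto.isBigO_one ℂ
  have hsq : (fun z : ℂ => z ^ 2) =O[𝓝 0] fun _ => (1 : ℂ) :=
    (show Continuous fun z : ℂ => z ^ 2 by fun_prop).continuousAt.tendsto.isBigO_one ℂ
  have h1 := hP.mul_isLittleO hg
  have h2 := hQ.mul_isLittleO hf
  have h3 := (hf.isBigO.trans hsq).mul_isLittleO hg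
  have h4 : (fun z : ℂ => ((b * c' + c * b') * z + c * c' * z ^ 2) * z ^ 2) =o[𝓝 0]
      fun z : ℂ => z ^ 2 := isLittleO_mul_sq_of_tendsto_zero (by
    have : Continuous fun z : ℂ => (b * c' + c * b') * z + c * c' * z ^ 2 := by fun_prop
    simpa using this.tendsto 0)
  simp only [one_mul] at h1 h2 h3
  exact (((h1.add h2).add h3).add h4).congr_left fun z => by ring

theorem HasTwoJet.exp (b c : ℂ) :
    HasTwoJet (fun z => Complex.exp (b * z + c * z ^ 2)) 1 b (c + b ^ 2 / 2) := by
  have hc : Continuous fun z : ℂ => b * z + c * z ^ 2 := by fun_prop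
  have h0 : Tendsto (fun z : ℂ => b * z + c * z ^ 2) (𝓝 0) (𝓝 0) := by simpa using hc.tendsto 0
  have h1 := (Complex.exp_sub_sum_range_succ_isLittleO_pow 2).comp_tendsto h0
  have h2 : (fun z : ℂ => (b * z + c * z ^ 2) ^ 2) =O[𝓝 0] fun z : ℂ => z ^ 2 := by
    have : (fun z : ℂ => (b + c * z) ^ 2) =O[𝓝 0] fun _ => (1 : ℂ) :=
      (show Continuous fun z : ℂ => (b + c * z) ^ 2 by fun_prop).continuousAt.tendsto.isBigO_one ℂ
    refine (this.mul (Asymptotics.isBigO_refl (fun z : ℂ => z ^ 2) (𝓝 0))).congr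
      (fun z => by ring) fun z => by ring
  have h3 : (fun z : ℂ => (b * c * z + c ^ 2 * z ^ 2 / 2) * z ^ 2) =o[𝓝 0]
      fun z : ℂ => z ^ 2 := isLittleO_mul_sq_of_tendsto_zero (by
    have : Continuous fun z : ℂ => b * c * z + c ^ 2 * z ^ 2 / 2 := by fun_prop
    simpa using this.tendsto 0)
  refine ((h1.trans_isBigO h2).add h3).congr_left fun z => ?_
  simp [Finset.sum_range_succ, Nat.factorial]
  ring

/-! ### Recurrences whose coefficients nearly sum to one -/

/-- If `d` satisfies a recurrence whose coefficients nearly sum to one, then it is nearly constant: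
`d (m + q + 1) + (β + γ) ∑_{1 ≤ i ≤ q} d (m + i) + γ d m` changes by `(α + β + γ - 1) d (m + q + 1)`
from `m` to `m + 1`. -/
theorem norm_sub_le_of_recurrence {d : ℕ → ℂ} {α β γ : ℂ} {q : ℕ}
    (hd : ∀ m, d (m + q + 2) = α * d (m + q + 1) + β * d (m + 1) + γ * d m)
    {K : ℝ} {N : ℕ} (hK : ∀ m ≤ N, ‖d m‖ ≤ K) (hN : q + 1 ≤ N) :
    ‖d N - d (q + 1)‖ ≤ N * ‖α + β + γ - 1‖ * K + 2 * (q * ‖β + γ‖ + ‖γ‖) * K := by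
  set S : ℕ → ℂ := fun m => (β + γ) * ∑ j ∈ Finset.range q, d (m + 1 + j) + γ * d m with hS
  have hK0 : 0 ≤ K := (norm_nonneg _).trans (hK 0 (Nat.zero_le _))
  have hstep : ∀ m, (d (m + 1 + q + 1) + S (m + 1)) - (d (m + q + 1) + S m)
      = (α + β + γ - 1) * d (m + q + 1) := by
    intro m
    have h1 : ∑ j ∈ Finset.range q, d (m + 1 + 1 + j) + d (m + 1)
        = ∑ j ∈ Finset.range q, d (m + 1 + j) + d (m + q + 1) := by
      have := Finset.sum_range_succ (fun j => d (m + 1 + j)) q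
      rw [Finset.sum_range_succ'] at this
      simpa [add_assoc, add_comm, add_left_comm] using this
    have h2 := hd m
    rw [show m + q + 2 = m + 1 + q + 1 by ring] at h2
    simp only [hS]
    rw [h2]
    linear_combination (β + γ) * h1
  have hL : ∀ m, m + q + 1 ≤ N →
      ‖(d (m + q + 1) + S m) - (d (q + 1) + S 0)‖ ≤ m * (‖α + β + γ - 1‖ * K) := by
    intro m
    induction m with
    | zero => intro _; simp
    | succ m ih =>
      intro hm
      have h1 := ih (by omega)
      have h2 : ‖(α + β + γ - 1) * d (m + q + 1)‖ ≤ ‖α + β + γ - 1‖ * K := by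
        rw [norm_mul]
        exact mul_le_mul_of_nonneg_left (hK _ (by omega)) (norm_nonneg _)
      have h3 : (d (m + 1 + q + 1) + S (m + 1)) - (d (q + 1) + S 0)
          = (α + β + γ - 1) * d (m + q + 1)
            + ((d (m + q + 1) + S m) - (d (q + 1) + S 0)) := by
        linear_combination hstep m
      rw [h3]
      refine (norm_add_le _ _).trans ?_
      push_cast
      linarith
  have hSb : ∀ m, m + q + 1 ≤ N → ‖S m‖ ≤ (q * ‖β + γ‖ + ‖γ‖) * K := by
    intro m hm
    have h1 : ‖∑ j ∈ Finset.range q, d (m + 1 + j)‖ ≤ q * K := by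
      refine (norm_sum_le_of_le _ (fun j hj => hK _ ?_)).trans (by simp)
      rw [Finset.mem_range] at hj
      omega
    have h2 := hK m (by omega)
    calc ‖S m‖ ≤ ‖β + γ‖ * ‖∑ j ∈ Finset.range q, d (m + 1 + j)‖ + ‖γ‖ * ‖d m‖ := by
          rw [← norm_mul, ← norm_mul]; exact norm_add_le _ _
      _ ≤ ‖β + γ‖ * (q * K) + ‖γ‖ * K := by gcongr
      _ = _ := by ring
  obtain ⟨m, rfl⟩ : ∃ m, N = m + q + 1 := ⟨N - (q + 1), by omega⟩
  have h1 := hL m le_rfl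
  have h2 := hSb m le_rfl
  have h3 := hSb 0 (by omega)
  have h4 : d (m + q + 1) - d (q + 1)
      = ((d (m + q + 1) + S m) - (d (q + 1) + S 0)) - S m + S 0 := by ring
  have h5 : (m : ℝ) * (‖α + β + γ - 1‖ * K) ≤ ((m + q + 1 : ℕ) : ℝ) * ‖α + β + γ - 1‖ * K := by
    rw [← mul_assoc]
    gcongr
    omega
  rw [h4]
  refine (norm_add_le _ _).trans ((add_le_add_left (norm_sub_le _ _) _).trans ?_)
  linarith

/-! ### The approximate growth factor -/

/-- The asymptotic mean of the number of `k`-cycles per point. -/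
noncomputable def meanRate (k : ℕ) : ℝ := 1 / 2 ^ (k + 1)

/-- The asymptotic variance of the number of `k`-cycles per point. -/
noncomputable def varianceRate (k : ℕ) : ℝ := ((2 : ℝ) ^ (k + 1) - 2 * k + 3) / 4 ^ (k + 1)

theorem varianceRate_pos (k : ℕ) : 0 < varianceRate k := by
  have : (k : ℝ) + 1 ≤ 2 ^ k := by exact_mod_cast Nat.lt_two_pow_self (n := k)
  refine div_pos ?_ (by positivity)
  rw [pow_succ]
  linarith

/-- The reciprocal of the approximate growth factor `exp (c z i - v z² / 2)` of the normalised
cycle-counting polynomials at `u = exp (z i)`. -/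
noncomputable def decay (k : ℕ) (z : ℂ) : ℂ :=
  Complex.exp (-(meanRate k * Complex.I) * z + (varianceRate k / 2 : ℝ) * z ^ 2)

/-- The coefficient of the term of lag `k` in the recurrence of the normalised polynomials; it vanishes
at `z = 0`. -/
noncomputable def pert (k : ℕ) (z : ℂ) : ℂ :=
  (Complex.exp (Complex.I * z) - 1) * (decay k z / 2) ^ k

theorem continuous_decay (k : ℕ) : Continuous (decay k) := by
  unfold decay; fun_prop

theorem continuous_pert (k : ℕ) : Continuous (pert k) := by
  have := continuous_decay k
  unfold pert; fun_prop

theorem decay_zero (k : ℕ) : decay k 0 = 1 := by simp [decay]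

theorem pert_zero (k : ℕ) : pert k 0 = 0 := by simp [pert]

/-- The exponents in `decay` solve the characteristic equation up to second order: the first-order
term fixes `meanRate`, the second-order term fixes `varianceRate`. -/
theorem decay_add_pert_isLittleO (k : ℕ) :
    (fun z => decay k z + pert k z * (1 - decay k z / 2) - 1) =o[𝓝 0] fun z : ℂ => z ^ 2 := by
  have hA : HasTwoJet (decay k) _ _ _ :=
    HasTwoJet.exp (-(meanRate k * Complex.I)) ((varianceRate k / 2 : ℝ) : ℂ)
  have hE : HasTwoJet (fun z => Complex.exp (Complex.I * z)) 1 Complex.I (-1 / 2) := by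
    simpa using HasTwoJet.exp Complex.I 0
  have hB := HasTwoJet.exp (k * -(meanRate k * Complex.I)) (k * ((varianceRate k / 2 : ℝ) : ℂ))
  have h := (hA.add (((hE.add (.const (-1))).mul ((HasTwoJet.const ((1 / 2) ^ k)).mul hB)).mul
    ((HasTwoJet.const 1).add ((HasTwoJet.const (-1 / 2)).mul hA)))).add (.const (-1))
  refine h.congr_left fun z => ?_
  have hpow : (decay k z / 2) ^ k = (1 / 2) ^ k * Complex.exp
      (k * -(meanRate k * Complex.I) * z + k * ((varianceRate k / 2 : ℝ) : ℂ) * z ^ 2) := by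
    rw [div_eq_mul_one_div, mul_pow, mul_comm, decay, ← Complex.exp_nat_mul]
    congr 2
    ring
  have hc : (meanRate k : ℂ) = (1 / 2) ^ k / 2 := by
    simp [meanRate, pow_succ]; ring
  have hv : ((varianceRate k / 2 : ℝ) : ℂ)
      = (1 / 2) ^ k / 4 + ((1 / 2) ^ k) ^ 2 * (3 - 2 * k) / 8 := by
    have h4 : (4 : ℂ) ^ (k + 1) = 4 * (2 ^ k) ^ 2 := by
      rw [pow_succ, ← pow_mul, mul_comm k 2, pow_mul]; norm_num; ring
    have h2 : (2 : ℂ) ^ k ≠ 0 := pow_ne_zero _ two_ne_zero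
    simp only [varianceRate]
    push_cast
    rw [h4, pow_succ, one_div, inv_pow]
    field_simp
    ring
  have hI : Complex.I ^ 2 = -1 := Complex.I_sq
  beta_reduce
  rw [pert, hpow, hv, hc]
  generalize ((1 : ℂ) / 2) ^ k = p
  linear_combination (-(p ^ 2 * (3 - 2 * k) / 8)) * z ^ 2 * hI

/-! ### The limit of the normalised polynomials -/

/-- The cycle-counting polynomial at `u = exp (i θ)`, divided by `2 ^ n` and by the approximate
growth factor to the power `n`. -/
noncomputable def normalizedPoly (k : ℕ) (θ : ℝ) (n : ℕ) : ℂ :=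
  cyclePoly k (Complex.exp (Complex.I * θ)) n * (decay k θ / 2) ^ n

theorem normalizedPoly_recurrence {k q : ℕ} (hq : k = q + 1) (θ : ℝ) (m : ℕ) :
    normalizedPoly k θ (m + q + 2) = decay k θ * normalizedPoly k θ (m + q + 1)
      + pert k θ * normalizedPoly k θ (m + 1)
      + -(pert k θ * (decay k θ / 2)) * normalizedPoly k θ m := by
  subst hq
  simp only [normalizedPoly, pert, cyclePoly_recurrence _ _ q m rfl]
  ring

theorem norm_decay (k : ℕ) (θ : ℝ) : ‖decay k θ‖ = Real.exp (varianceRate k / 2 * θ ^ 2) := by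
  rw [decay, Complex.norm_exp]
  congr 1
  simp [← Complex.ofReal_pow]

theorem norm_normalizedPoly_le (k : ℕ) (θ : ℝ) {m n : ℕ} (h : m ≤ n) :
    ‖normalizedPoly k θ m‖ ≤ Real.exp (varianceRate k / 2 * (n * θ ^ 2)) := by
  have hu : ‖Complex.exp (Complex.I * θ)‖ = 1 := by
    rw [mul_comm]; exact Complex.norm_exp_ofReal_mul_I θ
  have hv := varianceRate_pos k
  calc ‖normalizedPoly k θ m‖ ≤ 2 ^ m * ‖(decay k θ / 2) ^ m‖ := by
        rw [normalizedPoly, norm_mul]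
        exact mul_le_mul_of_nonneg_right (norm_cyclePoly_le k hu m) (norm_nonneg _)
    _ = Real.exp (varianceRate k / 2 * (m * θ ^ 2)) := by
        rw [norm_pow, norm_div, norm_decay, ← mul_pow, Complex.norm_ofNat,
          mul_div_cancel₀ _ (two_ne_zero' ℝ), ← Real.exp_nat_mul]
        congr 1; ring
    _ ≤ _ := by gcongr

theorem tendsto_zero_of_tendsto_mul_sq {θ : ℕ → ℝ} {s : ℝ}
    (hθ : Tendsto (fun n : ℕ => n * θ n ^ 2) atTop (𝓝 s)) : Tendsto θ atTop (𝓝 0) := by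
  have h1 := hθ.mul (tendsto_inv_atTop_nhds_zero_nat (𝕜 := ℝ))
  rw [mul_zero] at h1
  have h2 : Tendsto (fun n => θ n ^ 2) atTop (𝓝 0) := by
    refine h1.congr' ?_
    filter_upwards [eventually_ne_atTop 0] with n hn
    have : (n : ℝ) ≠ 0 := by exact_mod_cast hn
    field_simp
  have h3 := h2.sqrt
  simp only [Real.sqrt_sq_eq_abs, Real.sqrt_zero] at h3
  exact (tendsto_zero_iff_abs_tendsto_zero _).2 h3

theorem tendsto_normalizedPoly {k : ℕ} (hk : 1 ≤ k) {θ : ℕ → ℝ} {s : ℝ}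
    (hθ : Tendsto (fun n : ℕ => n * θ n ^ 2) atTop (𝓝 s)) :
    Tendsto (fun n => normalizedPoly k (θ n) n) atTop (𝓝 (1 / 2)) := by
  obtain ⟨q, rfl⟩ : ∃ q, k = q + 1 := ⟨k - 1, by omega⟩
  set k := q + 1 with hq
  have hθ0 : Tendsto (fun n => (θ n : ℂ)) atTop (𝓝 0) := by
    exact_mod_cast (Complex.continuous_ofReal.tendsto 0).comp (tendsto_zero_of_tendsto_mul_sq hθ)
  have hdec : Tendsto (fun n => decay k (θ n)) atTop (𝓝 1) := by
    exact ((continuous_decay k).tendsto' 0 1 (decay_zero k)).comp hθ0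
  have hpert : Tendsto (fun n => pert k (θ n)) atTop (𝓝 0) := by
    exact ((continuous_pert k).tendsto' 0 0 (pert_zero k)).comp hθ0
  -- the value at the fixed index `k` tends to the share `2 ^ (k - 1) / 2 ^ k`
  have hbase : Tendsto (fun n => normalizedPoly k (θ n) k) atTop (𝓝 (1 / 2)) := by
    have h1 : Tendsto (fun n => Complex.exp (Complex.I * θ n)) atTop (𝓝 1) := by
      have : Continuous fun z : ℂ => Complex.exp (Complex.I * z) := by fun_prop
      exact (this.tendsto' 0 1 (by simp)).comp hθ0
    have h2 := ((continuous_cyclePoly k k).tendsto 1).comp h1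
    have h3 := h2.mul ((hdec.div_const 2).pow k)
    have h4 : cyclePoly k 1 k * (1 / 2) ^ k = 1 / 2 := by
      rw [hq, cyclePoly_one, pow_succ, ← mul_assoc, ← mul_pow]
      norm_num
    rwa [h4] at h3
  have hbound : ∀ᶠ n : ℕ in atTop, ‖normalizedPoly k (θ n) n - normalizedPoly k (θ n) k‖ ≤
      n * ‖decay k (θ n) + pert k (θ n) + -(pert k (θ n) * (decay k (θ n) / 2)) - 1‖
          * Real.exp (varianceRate k / 2 * (n * θ n ^ 2))
        + 2 * (q * ‖pert k (θ n) + -(pert k (θ n) * (decay k (θ n) / 2))‖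
          + ‖-(pert k (θ n) * (decay k (θ n) / 2))‖)
          * Real.exp (varianceRate k / 2 * (n * θ n ^ 2)) := by
    filter_upwards [eventually_ge_atTop k] with n hn
    exact norm_sub_le_of_recurrence (normalizedPoly_recurrence hq (θ n))
      (fun m hm => norm_normalizedPoly_le k (θ n) hm) hn
  have hexp : Tendsto (fun n : ℕ => Real.exp (varianceRate k / 2 * (n * θ n ^ 2))) atTop
      (𝓝 (Real.exp (varianceRate k / 2 * s))) :=
    (Real.continuous_exp.tendsto _).comp (hθ.const_mul _)
  have hres : Tendsto (fun n : ℕ => n *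
      ‖decay k (θ n) + pert k (θ n) + -(pert k (θ n) * (decay k (θ n) / 2)) - 1‖) atTop (𝓝 0) := by
    have h1 := ((decay_add_pert_isLittleO k).comp_tendsto hθ0).norm_norm
    have h2 : (fun n : ℕ => (n : ℝ) * ‖decay k (θ n) + pert k (θ n)
        + -(pert k (θ n) * (decay k (θ n) / 2)) - 1‖) =o[atTop] fun n : ℕ => (n : ℝ) * θ n ^ 2 := by
      refine ((Asymptotics.isBigO_refl (fun n : ℕ => (n : ℝ)) atTop).mul_isLittleO h1).congr
        (fun n => ?_) fun n => ?_
      · simp only [Function.comp]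
        congr 2
        ring
      · simp
    exact (Asymptotics.isLittleO_one_iff ℝ).1 (h2.trans_isBigO (hθ.isBigO_one ℝ))
  have hpd : Tendsto (fun n => pert k (θ n) * (decay k (θ n) / 2)) atTop (𝓝 0) := by
    simpa using hpert.mul (hdec.div_const 2)
  have hlim := (hres.mul hexp).add
    ((((hpert.add hpd.neg).norm.const_mul (q : ℝ)).add hpd.neg.norm).const_mul 2 |>.mul hexp)
  simp only [neg_zero, add_zero, norm_zero, mul_zero, zero_mul] at hlim
  have := (squeeze_zero_norm' hbound hlim).add hbase
  simpa using this

/-- Passing from the centring `n * meanRate k` to `mean n k` costs a phase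
`θ * meanRate k * (3 - k)`, which vanishes in the limit. -/
theorem tendsto_cyclePoly {k : ℕ} (hk : 1 ≤ k) {θ : ℕ → ℝ} {s : ℝ}
    (hθ : Tendsto (fun n : ℕ => n * θ n ^ 2) atTop (𝓝 s)) :
    Tendsto (fun n => cyclePoly k (Complex.exp (Complex.I * θ n)) n / (2 ^ n / 2)
      * Complex.exp (-(θ n * mean n k * Complex.I))) atTop
      (𝓝 (Complex.exp (-(varianceRate k / 2 * s : ℝ)))) := by
  have hθ0 : Tendsto (fun n => (θ n : ℂ)) atTop (𝓝 0) := by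
    exact_mod_cast (Complex.continuous_ofReal.tendsto 0).comp (tendsto_zero_of_tendsto_mul_sq hθ)
  have h1 : Tendsto (fun n : ℕ => Complex.exp (-(varianceRate k / 2 * (n * θ n ^ 2) : ℝ))) atTop
      (𝓝 (Complex.exp (-(varianceRate k / 2 * s : ℝ)))) := by
    have : Continuous fun x : ℝ => Complex.exp (-(varianceRate k / 2 * x : ℝ)) := by fun_prop
    exact (this.tendsto s).comp hθ
  have h2 : Tendsto (fun n => Complex.exp (-(θ n * (meanRate k * (3 - k)) * Complex.I))) atTop
      (𝓝 1) := by
    have : Continuous fun z : ℂ => Complex.exp (-(z * (meanRate k * (3 - k)) * Complex.I)) := by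
      fun_prop
    exact (this.tendsto' 0 1 (by simp)).comp hθ0
  have h3 := (((tendsto_normalizedPoly hk hθ).const_mul 2).mul h1).mul h2
  rw [show (2 : ℂ) * (1 / 2) * Complex.exp (-(varianceRate k / 2 * s : ℝ)) * 1
    = Complex.exp (-(varianceRate k / 2 * s : ℝ)) by ring] at h3
  refine h3.congr fun n => ?_
  have hm : mean n k = meanRate k * n + meanRate k * (3 - k) := by
    rw [mean, meanRate]; ring
  have hd : Complex.exp (-(θ n * mean n k * Complex.I))
      = decay k (θ n) ^ n * Complex.exp (-(varianceRate k / 2 * (n * θ n ^ 2) : ℝ))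
        * Complex.exp (-(θ n * (meanRate k * (3 - k)) * Complex.I)) := by
    rw [decay, ← Complex.exp_nat_mul, ← Complex.exp_add, ← Complex.exp_add, hm]
    congr 1
    push_cast
    ring
  have h2n : (2 : ℂ) ^ n ≠ 0 := pow_ne_zero _ two_ne_zero
  rw [hd, normalizedPoly, div_pow]
  field_simp

/-! ### Convergence in law -/

instance (n : ℕ) : DiscreteMeasurableSpace (Equiv.Perm (Fin n)) := ⟨fun _ => trivial⟩

instance (n : ℕ) : IsProbabilityMeasure (uniformLaw n) :=
  isProbabilityMeasure_uniformOn (Set.toFinite _) ⟨1, fun i _ => by simp⟩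

theorem integral_uniformLaw (n : ℕ) (f : Equiv.Perm (Fin n) → ℂ) :
    ∫ π, f π ∂uniformLaw n = (∑ π ∈ (regularPerms n).toFinite.toFinset, f π)
      / (regularPerms n).toFinite.toFinset.card := by
  have hs : (regularPerms n) = ↑(regularPerms n).toFinite.toFinset := by simp
  have h : Measure.count (regularPerms n) = (regularPerms n).toFinite.toFinset.card := by
    conv_lhs => rw [hs]
    rw [Measure.count_apply_finset]
  rw [uniformLaw, uniformOn, ProbabilityTheory.cond, integral_smul_measure, h]
  conv_lhs => rw [hs]
  rw [setIntegral_finset _ Integrable.of_finite.integrableOn]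
  simp [Measure.real, div_eq_inv_mul]

/-- The law of the standardised number of `k`-cycles. -/
noncomputable def standardizedLaw (k n : ℕ) : ProbabilityMeasure ℝ :=
  ⟨(uniformLaw n).map fun π => ((cycleCount k π : ℝ) - mean n k) / stdDev n k,
    Measure.isProbabilityMeasure_map (measurable_of_finite _).aemeasurable⟩

theorem coe_standardizedLaw (k n : ℕ) : (standardizedLaw k n : Measure ℝ) =
    (uniformLaw n).map fun π => ((cycleCount k π : ℝ) - mean n k) / stdDev n k := rfl

theorem charFun_standardizedLaw (k n : ℕ) (t : ℝ) :
    charFun (standardizedLaw k n : Measure ℝ) t =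
      cyclePoly k (Complex.exp (Complex.I * (t / stdDev n k : ℝ))) n
        / (regularPerms n).toFinite.toFinset.card
        * Complex.exp (-((t / stdDev n k : ℝ) * mean n k * Complex.I)) := by
  rw [coe_standardizedLaw, charFun_apply_real,
    integral_map (measurable_of_finite _).aemeasurable (by fun_prop), integral_uniformLaw,
    cyclePoly, div_mul_eq_mul_div, Finset.sum_mul]
  congr 1
  refine Finset.sum_congr rfl fun π _ => ?_
  rw [← Complex.exp_nat_mul, ← Complex.exp_add]
  congr 1
  push_cast
  ring

/-- The scaling constant `stdDev n k` is asymptotic to `√(n * varianceRate k)`. -/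
theorem tendsto_mul_sq_div_stdDev (k : ℕ) (t : ℝ) :
    Tendsto (fun n : ℕ => n * (t / stdDev n k) ^ 2) atTop (𝓝 (t ^ 2 / varianceRate k)) := by
  set e : ℝ := (3 * k * ((k : ℝ) - 4) + (3 - (k : ℝ)) * 2 ^ (k + 1) + 5) / 4 ^ (k + 1) with he
  have hv : ∀ n : ℕ, variance n k = varianceRate k * n + e := fun n => by
    rw [variance, varianceRate, he]; ring
  have h1 : Tendsto (fun n : ℕ => varianceRate k + e * (n : ℝ)⁻¹) atTop (𝓝 (varianceRate k)) := by
    simpa using (tendsto_inv_atTop_nhds_zero_nat (𝕜 := ℝ)).const_mul e |>.const_add (varianceRate k)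
  have h2 := (tendsto_const_nhds (x := t ^ 2)).div h1 (varianceRate_pos k).ne'
  refine h2.congr' ?_
  filter_upwards [h1.eventually (lt_mem_nhds (varianceRate_pos k)), eventually_gt_atTop 0]
    with n hn hn0
  have hn0 : (0 : ℝ) < n := by exact_mod_cast hn0
  have h3 : variance n k = n * (varianceRate k + e * (n : ℝ)⁻¹) := by
    rw [hv]; field_simp
  have h4 : 0 ≤ variance n k := by rw [h3]; positivity
  simp only [Pi.div_apply]
  rw [stdDev, div_pow, Real.sq_sqrt h4, h3]
  field_simp

/-- The standard normal law, bundled. -/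
noncomputable def stdNormal : ProbabilityMeasure ℝ := ⟨gaussianReal 0 1, inferInstance⟩

theorem coe_stdNormal : (stdNormal : Measure ℝ) = gaussianReal 0 1 := rfl

theorem tendsto_standardizedLaw {k : ℕ} (hk : 1 ≤ k) :
    Tendsto (standardizedLaw k) atTop (𝓝 stdNormal) := by
  refine ProbabilityMeasure.tendsto_of_tendsto_charFun fun t => ?_
  have h := tendsto_cyclePoly hk (tendsto_mul_sq_div_stdDev k t)
  have hlim : charFun (stdNormal : Measure ℝ) t
      = Complex.exp (-(varianceRate k / 2 * (t ^ 2 / varianceRate k) : ℝ)) := by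
    have hv := (varianceRate_pos k).ne'
    rw [coe_stdNormal, charFun_gaussianReal,
      show varianceRate k / 2 * (t ^ 2 / varianceRate k) = t ^ 2 / 2 by field_simp]
    congr 1
    push_cast
    ring
  rw [hlim]
  refine h.congr' ?_
  filter_upwards [eventually_ne_atTop 0] with n hn
  obtain ⟨n, rfl⟩ := Nat.exists_eq_succ_of_ne_zero hn
  rw [charFun_standardizedLaw, Nat.succ_eq_add_one, card_regularPerms, pow_succ]
  push_cast
  rw [mul_div_cancel_right₀ _ (two_ne_zero' ℂ)]

theorem gaussianReal_real_Iio (t : ℝ) : (gaussianReal 0 1).real (Set.Iio t)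
    = 1 / √(2 * Real.pi) * ∫ x in Set.Iic t, Real.exp (-x ^ 2 / 2) := by
  rw [Measure.real, gaussianReal_apply_eq_integral 0 one_ne_zero, ENNReal.toReal_ofReal
    (integral_nonneg fun x => gaussianPDFReal_nonneg 0 1 x), ← integral_Iic_eq_integral_Iio,
    ← integral_const_mul]
  simp [gaussianPDFReal]

end RestrictedPerm

theorem theorem1p1 (k : ℕ) (hk : 1 ≤ k) (t : ℝ) :
    Tendsto
      (fun n : ℕ => (RestrictedPerm.uniformLaw n).real
        {π | ((RestrictedPerm.cycleCount k π : ℝ) - RestrictedPerm.mean n k)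
              / RestrictedPerm.stdDev n k < t})
      atTop
      (𝓝 (1 / √(2 * Real.pi) * ∫ x in Set.Iic t, Real.exp (-x ^ 2 / 2))) := by
  have hnull : (RestrictedPerm.stdNormal : Measure ℝ)
      (frontier (Set.Iio t)) = 0 := by
    have := nullSingletonClass_gaussianReal (μ := 0) (v := 1) one_ne_zero
    rw [frontier_Iio, RestrictedPerm.coe_stdNormal]
    exact measure_singleton t
  have h := ProbabilityMeasure.tendsto_measure_of_null_frontier_of_tendsto'
    (RestrictedPerm.tendsto_standardizedLaw hk) hnull
  rw [← RestrictedPerm.gaussianReal_real_Iio, ← RestrictedPerm.coe_stdNormal]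
  refine ((ENNReal.tendsto_toReal (measure_ne_top _ _)).comp h).congr fun n => ?_
  rw [Function.comp_apply, RestrictedPerm.coe_standardizedLaw,
    Measure.map_apply (measurable_of_finite _) measurableSet_Iio]
  rfl
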